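/- Let $\mathsf M$ be an MDP with finite state space $\mathcal S$, finite action space $\mathcal A$, transition probabilities $p(s,a,s')$ and reward distributions on $\mathbb R$ with finite means $r(s,a)$; let $\pi(a\mid s)$ be a policy and $\phi:\mathcal S\times\mathcal A\to\mathbb R^d$ a feature map with $\|\phi(s,a)\|_2\le 1$ for all $(s,a)$. Let $m=|\mathcal S||\mathcal A|$, let $\Phi\in\mathbb R^{m\times d}$ be the matrix with rows $\phi(s,a)^\top$, let $T((s,a),s')=p(s,a,s')$, and let $\Pi(s,(s',a'))=\pi(a'\mid s)\,\mathbb I\{s=s'\}$. Call $\mathsf M$ *linear* (with respect to $\Phi$) if $T=\Phi\mu^\top$ and $r=\Phi\theta$ for some $\mu\in\mathbb R^{|\mathcal S|\times d}$ with $\|\mu(s)\|_2\le\sqrt d$ for all $s$ and some $\theta\in\mathbb R^d$ with $\|\theta\|_2\le\sqrt d$. Let $$Q\big((s,a),(s',a')\big)=p(s,a,s')\,\pi(a'\mid s')$$ be the induced transition matrix on $\mathcal S\times\mathcal A$, and let the null class $\mathcal P_L$ be the set of all stochastic $m\times m$ matrices of the form $P=\Phi\mu^\top\Pi$ with $\mu\in\mathbb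 R^{|\mathcal S|\times d}$ and $\|\mu\|_{2,\infty}=\max_s\|\mu(s)\|_2\le\sqrt d$. For probability vectors let $\mathrm{KL}(q,p)=\sum_j q_j\log(q_j/p_j)$ ($0\log 0=0$; $+\infty$ unless $q\ll p$). If $Q$ is ergodic with stationary distribution $\rho$, let $$D_{\mathcal M}^{\inf}(Q,\mathcal P_L)=\inf_{P\in\mathcal P_L}\sum_{i}\rho_i\,\mathrm{KL}\big(Q(i,\cdot),P(i,\cdot)\big)\in[0,\infty],\qquad \inf\varnothing=+\infty .$$ Test: from $X_0,X_1,\dots$ in $\mathcal S\times\mathcal A$, let $N_i(t)=\#\{s<t: X_s=i\}$, $N_{i,j}(t)=\#\{s<t: X_s=i,\ X_{s+1}=j\}$, and $\widehat Q_t(i,j)=N_{i,j}(t)/N_i(t)$ when $N_i(t)>0$. Let $$L_t=\inf_{P\in\mathcal P_L}\sum_{i:N_i(t)>0}N_i(t)\,\mathrm{KL}\big(\widehat Q_t(i,\cdot),P(i,\cdot)\big),$$ $$\beta_t=\log(1/\alpha)+(m-1)\sum_{i}\log\Big(e\Big(1+\frac{N_i(t)}{m-1}\Big)\Big)$$ (when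 $m=1$, $\beta_t=\log(1/\alpha)$), and $\tau_\alpha=\inf\{t\ge1: L_t\ge\beta_t\}$. **Corollary.** Suppose that $\mathsf M$ is not linear with respect to $\Phi$ and that $Q$ is ergodic (irreducible and aperiodic). Then $\mathcal P_L$ is compact, and for every initial distribution, if $(X_t)_{t\ge0}$ is a Markov chain with transition matrix $Q$, then $$\limsup_{\alpha\downarrow0}\frac{\mathbb E_Q[\tau_\alpha]}{\log(1/\alpha)}\ \le\ \frac{1}{D_{\mathcal M}^{\inf}(Q,\mathcal P_L)},$$ with the conventions $1/0=\infty$ and $1/\infty=0$. -/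

import Mathlib

open Filter Topology MeasureTheory
open scoped ENNReal Matrix

namespace MarkovTest

noncomputable section

/-! ### Finite-state Markov chains -/

section Chains

variable {ι : Type*} [Fintype ι] [DecidableEq ι]

/-- Every state has period one: `1` is the only common divisor of its possible return times. -/
def IsAperiodic (P : Matrix ι ι ℝ) : Prop :=
  ∀ i, ∀ k : ℕ, (∀ n : ℕ, 1 ≤ n → 0 < (P ^ n) i i → k ∣ n) → k = 1

/-- An ergodic transition matrix: row-stochastic, irreducible and aperiodic. -/
structure IsErgodic (P : Matrix ι ι ℝ) : Prop where
  stochastic : P ∈ Matrix.rowStochastic ℝ ι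
  irreducible : P.IsIrreducible
  aperiodic : IsAperiodic P

/-- `ρ` is a probability vector with `ρ P = ρ`. -/
def IsStationary (P : Matrix ι ι ℝ) (ρ : ι → ℝ) : Prop :=
  ρ ∈ stdSimplex ℝ ι ∧ ρ ᵥ* P = ρ

open scoped Classical in
/-- The stationary distribution of `P` (it exists and is unique when `P` is ergodic;
junk value `0` when there is none). -/
def stationaryDist (P : Matrix ι ι ℝ) : ι → ℝ :=
  if h : ∃ ρ, IsStationary P ρ then h.choose else 0

/-- The process `X₀, X₁, …` on the probability space `(Ω, ℙ)` is a Markov chain with transition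
matrix `Q` and initial distribution `ν`, expressed by its finite-dimensional distributions. -/
structure IsMarkovChain {Ω : Type*} [MeasurableSpace Ω] (ℙ : Measure Ω) (X : ℕ → Ω → ι)
    (ν : ι → ℝ) (Q : Matrix ι ι ℝ) : Prop where
  measurable : ∀ (t : ℕ) (i : ι), MeasurableSet {ω | X t ω = i}
  law : ∀ (n : ℕ) (x : ℕ → ι),
    ℙ.real {ω | ∀ t ≤ n, X t ω = x t} = ν (x 0) * ∏ t ∈ Finset.range n, Q (x t) (x (t + 1))

end Chains

/-! ### Kullback-Leibler divergences -/

section Divergence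

variable {ι : Type*} [Fintype ι]

/-- Gibbs' inequality: the sum that defines the divergence is nonnegative, so that nothing is lost
by `ENNReal.ofReal` in the definition of `kl`. -/
theorem kl_sum_nonneg {q p : ι → ℝ} (hq : q ∈ stdSimplex ℝ ι) (hp : p ∈ stdSimplex ℝ ι)
    (hqp : ∀ j, p j = 0 → q j = 0) : 0 ≤ ∑ j, q j * Real.log (q j / p j) := by
  have h : ∀ j, q j - p j ≤ q j * Real.log (q j / p j) := by
    intro j
    rcases (hq.1 j).eq_or_lt with h0 | h0
    · rw [← h0]; simpa using hp.1 j
    · have hpj : 0 < p j := lt_of_le_of_ne (hp.1 j) (fun e => h0.ne' (hqp j e.symm))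
      have h1 := Real.one_sub_inv_le_log_of_pos (div_pos h0 hpj)
      have h2 := mul_le_mul_of_nonneg_left h1 h0.le
      have h3 : q j * (1 - (q j / p j)⁻¹) = q j - p j := by
        field_simp
      linarith
  have h' := Finset.sum_le_sum (fun j (_ : j ∈ Finset.univ) => h j)
  rw [Finset.sum_sub_distrib, hq.2, hp.2] at h'
  linarith

open scoped Classical in
/-- `KL(q, p) = ∑ⱼ qⱼ log (qⱼ / pⱼ)` for probability vectors `q`, `p`, with `0 log 0 = 0`, and
`KL(q, p) = ∞` unless `q ≪ p`. -/
def kl (q p : ι → ℝ) : ℝ≥0∞ :=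
  if ∀ j, p j = 0 → q j = 0 then ENNReal.ofReal (∑ j, q j * Real.log (q j / p j)) else ⊤

/-- The stationary-weighted divergence `∑ᵢ πᵢ KL(Q(i,·), P(i,·))`, where `π` is the stationary
distribution of `Q`. -/
def stationaryKL (Q P : Matrix ι ι ℝ) : ℝ≥0∞ :=
  ∑ i, ENNReal.ofReal (stationaryDist Q i) * kl (Q i) (P i)

/-- The infimum of the stationary-weighted divergence over a set of transition matrices
(`∞` for the empty set). -/
def infStationaryKL (Q : Matrix ι ι ℝ) (H₀ : Set (Matrix ι ι ℝ)) : ℝ≥0∞ :=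
  ⨅ P ∈ H₀, stationaryKL Q P

end Divergence

/-! ### The sequential test, as a function of the observed path `x₀, x₁, …` -/

section Test

variable {ι : Type*} [Fintype ι] [DecidableEq ι]

/-- `N_i(t)`: the number of visits to `i` among `x₀, …, x_{t-1}`. -/
def visits (x : ℕ → ι) (t : ℕ) (i : ι) : ℕ :=
  ((Finset.range t).filter (fun s => x s = i)).card

/-- `N_{i,j}(t)`: the number of transitions from `i` to `j` among the first `t` transitions. -/
def transitions (x : ℕ → ι) (t : ℕ) (i j : ι) : ℕ :=
  ((Finset.range t).filter (fun s => x s = i ∧ x (s + 1) = j)).card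

/-- The empirical transition matrix after `t` transitions; unvisited rows are uniform. -/
def empirical (x : ℕ → ι) (t : ℕ) : Matrix ι ι ℝ := Matrix.of fun i j =>
  if 0 < visits x t i then (transitions x t i j : ℝ) / (visits x t i : ℝ)
  else 1 / (Fintype.card ι : ℝ)

/-- `ψ_t = ∑ᵢ log (e (1 + N_i(t) / (m - 1)))`, where `m` is the number of states. -/
def psi (x : ℕ → ι) (t : ℕ) : ℝ :=
  ∑ i, Real.log (Real.exp 1 * (1 + (visits x t i : ℝ) / ((Fintype.card ι : ℝ) - 1)))

/-- The stopping boundary `β_t = log (1/α) + (m - 1) ψ_t`. -/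
def boundary (α : ℝ) (x : ℕ → ι) (t : ℕ) : ℝ :=
  Real.log (1 / α) + ((Fintype.card ι : ℝ) - 1) * psi x t

/-- The statistic `L_t = inf_{P ∈ H₀} ∑_{i : N_i(t) > 0} N_i(t) KL(Q̂_t(i,·), P(i,·))`. -/
def statistic (H₀ : Set (Matrix ι ι ℝ)) (x : ℕ → ι) (t : ℕ) : ℝ≥0∞ :=
  ⨅ P ∈ H₀, ∑ i ∈ Finset.univ.filter (fun i => 0 < visits x t i),
    (visits x t i : ℝ≥0∞) * kl (empirical x t i) (P i)

/-- The first time `t ≥ 1` at which `L_t ≥ β_t` (`∞` if there is none): the stopping time of the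
level-`α` test of the null hypothesis `H₀`. -/
def stoppingTime (H₀ : Set (Matrix ι ι ℝ)) (α : ℝ) (x : ℕ → ι) : ℕ∞ :=
  ⨅ (t : ℕ) (_ : 1 ≤ t ∧ ENNReal.ofReal (boundary α x t) ≤ statistic H₀ x t), (t : ℕ∞)

/-- The expected stopping time of the test run on the process `X`. -/
def expectedStoppingTime {Ω : Type*} [MeasurableSpace Ω] (ℙ : Measure Ω) (X : ℕ → Ω → ι)
    (H₀ : Set (Matrix ι ι ℝ)) (α : ℝ) : ℝ≥0∞ :=
  ∫⁻ ω, ((stoppingTime H₀ α (fun t => X t ω) : ℕ∞) : ℝ≥0∞) ∂ℙ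

end Test

/-! ### Markov decision processes with finitely many states and actions -/

section MDP

variable {S A : Type*} [Fintype S] [Fintype A] [DecidableEq S] [DecidableEq A]

/-- A finite Markov decision process: transition probabilities `trans s a s'` and reward
distributions on `ℝ` with finite mean. -/
structure FiniteMDP (S A : Type*) [Fintype S] where
  trans : S → A → S → ℝ
  trans_mem : ∀ s a, trans s a ∈ stdSimplex ℝ S
  rewardDist : S → A → ProbabilityMeasure ℝ
  integrable_reward : ∀ s a, Integrable (fun x : ℝ => x) (rewardDist s a : Measure ℝ)

/-- A stationary randomized policy: `prob s a` is the probability of the action `a` in `s`. -/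
structure Policy (S A : Type*) [Fintype A] where
  prob : S → A → ℝ
  prob_mem : ∀ s, prob s ∈ stdSimplex ℝ A

/-- The transition matrix of the MDP, with rows indexed by state-action pairs. -/
def FiniteMDP.transMatrix (M : FiniteMDP S A) : Matrix (S × A) S ℝ :=
  Matrix.of fun z s' => M.trans z.1 z.2 s'

/-- The expected rewards. -/
def FiniteMDP.meanReward (M : FiniteMDP S A) : S × A → ℝ :=
  fun z => ∫ x, x ∂(M.rewardDist z.1 z.2 : Measure ℝ)

/-- The policy matrix `Π(s, (s', a')) = π(a' | s) 𝟙{s = s'}`. -/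
def Policy.matrix (π : Policy S A) : Matrix S (S × A) ℝ :=
  Matrix.of fun s z => if s = z.1 then π.prob s z.2 else 0

/-- The transition matrix of the chain of state-action pairs that the policy induces. -/
def FiniteMDP.inducedKernel (M : FiniteMDP S A) (π : Policy S A) : Matrix (S × A) (S × A) ℝ :=
  Matrix.of fun z z' => M.trans z.1 z.2 z'.1 * π.prob z'.1 z'.2

/-- The feature matrix `Φ`, whose row at `(s, a)` is `φ(s, a)`. -/
def featureMatrix {d : ℕ} (φ : S → A → EuclideanSpace ℝ (Fin d)) : Matrix (S × A) (Fin d) ℝ :=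
  Matrix.of fun z k => φ z.1 z.2 k

/-- The norm `‖μ‖_{2,∞}`: the largest Euclidean norm of a row. -/
def normTwoInf {d : ℕ} (μ : Matrix S (Fin d) ℝ) : ℝ :=
  ⨆ s, ‖(WithLp.toLp 2 (μ s) : EuclideanSpace ℝ (Fin d))‖

/-- `M` is linear with respect to `φ`: `T = Φ μᵀ` and `r = Φ θ`, where `‖θ‖₂ ≤ √d` and every row of
`μ` has Euclidean norm at most `√d`. -/
def FiniteMDP.IsLinear {d : ℕ} (M : FiniteMDP S A) (φ : S → A → EuclideanSpace ℝ (Fin d)) : Prop :=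
  ∃ (μ : Matrix S (Fin d) ℝ) (θ : EuclideanSpace ℝ (Fin d)),
    M.transMatrix = featureMatrix φ * μᵀ ∧
    M.meanReward = featureMatrix φ *ᵥ (fun k => θ k) ∧
    ‖θ‖ ≤ √(d : ℝ) ∧
    ∀ s, ‖(WithLp.toLp 2 (μ s) : EuclideanSpace ℝ (Fin d))‖ ≤ √(d : ℝ)

/-- The null class: the transition matrices on state-action pairs of the form `Φ μᵀ Π` with
`‖μ‖_{2,∞} ≤ √d`. -/
def linearNull {d : ℕ} (φ : S → A → EuclideanSpace ℝ (Fin d)) (π : Policy S A) :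
    Set (Matrix (S × A) (S × A) ℝ) :=
  {P | P ∈ Matrix.rowStochastic ℝ (S × A) ∧
    ∃ μ : Matrix S (Fin d) ℝ, normTwoInf μ ≤ √(d : ℝ) ∧ P = featureMatrix φ * μᵀ * π.matrix}

end MDP

end

end MarkovTest

open MarkovTest

/-! Under `Q` the transition frequencies `N_{i,j}(t)/t` converge to `ρ_i Q(i,j)`, so `L_t` should
grow at least at any linear rate below the information bound `D`, while the boundary is `log (1/α)`
plus a term of order `log t`. Crossing therefore takes about `log (1/α) / D` steps. Two points need
proof.

Uniformity over the null class: KL is not continuous and may be infinite, but it is the supremum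
over `h` of functionals jointly continuous in both arguments (`klDual`). If `c < D`, each `P` in the
null class has some `h` whose functional exceeds `c`, and this persists near `P` and near the
stationary frequencies. Compactness of the class gives one neighbourhood of the frequencies on which
the statistic is at least `c t` (`exists_statistic_lower_bound`).

Expectation rather than almost sure convergence: after a Poisson-equation correction, additive
functionals satisfy an exponential Chernoff bound (`IsMarkovChain.concentration`), so the expected
number of times with atypical frequencies is finite. Since `τ_α` is at most a deterministic `log
(1/α) / c + O(1)` plus that number, the bound on the mean follows. -/

namespace MarkovTest

/-! ### Stationary distributions and the Poisson equation -/

section Stationary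

variable {ι : Type*} [Fintype ι] [DecidableEq ι]

/-- Every stochastic matrix on a nonempty finite type has a stationary distribution. -/
theorem exists_isStationary [Nonempty ι] {Q : Matrix ι ι ℝ}
    (hQ : Q ∈ Matrix.rowStochastic ℝ ι) : ∃ ρ, IsStationary Q ρ := by
  have hrow := fun i => Matrix.sum_row_of_mem_rowStochastic hQ i
  have hnn := fun i j => Matrix.nonneg_of_mem_rowStochastic hQ (i := i) (j := j)
  -- The constants lie in the right kernel of `1 - Q`, so its left kernel is nontrivial too.
  have hdet : (1 - Q).det = 0 := by
    rw [← Matrix.exists_mulVec_eq_zero_iff]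
    exact ⟨1, one_ne_zero, by
      rw [Matrix.sub_mulVec, Matrix.one_mulVec, Matrix.one_vecMul_of_mem_rowStochastic hQ, sub_self]⟩
  obtain ⟨v, hv0, hv⟩ := Matrix.exists_vecMul_eq_zero_iff.mpr hdet
  rw [Matrix.vecMul_sub, Matrix.vecMul_one, sub_eq_zero] at hv
  have hv' : ∀ j, v j = ∑ i, v i * Q i j := fun j => congrFun hv j
  -- The triangle inequality gives `|v| ≤ |v| Q`. Both sides have the same total mass, so equality
  -- holds entrywise and `|v|` can be normalized.
  have hle : ∀ j ∈ Finset.univ, |v j| ≤ ∑ i, |v i| * Q i j := by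
    intro j _
    conv_lhs => rw [hv' j]
    refine (Finset.abs_sum_le_sum_abs _ _).trans (Finset.sum_le_sum fun i _ => ?_)
    rw [abs_mul, abs_of_nonneg (hnn i j)]
  have hsum : ∑ j, |v j| = ∑ j, ∑ i, |v i| * Q i j := by
    rw [Finset.sum_comm]
    simp_rw [← Finset.mul_sum, hrow, mul_one]
  have heq := (Finset.sum_eq_sum_iff_of_le hle).mp hsum
  have hpos : 0 < ∑ j, |v j| := by
    obtain ⟨j, hj⟩ := Function.ne_iff.mp hv0
    exact Finset.sum_pos' (fun _ _ => abs_nonneg _) ⟨j, Finset.mem_univ _, abs_pos.mpr hj⟩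
  refine ⟨fun i => |v i| / ∑ j, |v j|, ⟨fun i => by positivity, ?_⟩, ?_⟩
  · rw [← Finset.sum_div, div_self hpos.ne']
  · funext j
    simp only [Matrix.vecMul, dotProduct]
    rw [heq j (Finset.mem_univ _), Finset.sum_div]
    exact Finset.sum_congr rfl fun i _ => by ring

theorem stationaryDist_isStationary [Nonempty ι] {Q : Matrix ι ι ℝ}
    (hQ : Q ∈ Matrix.rowStochastic ℝ ι) : IsStationary Q (stationaryDist Q) := by
  have h := exists_isStationary hQ
  rw [stationaryDist, dif_pos h]
  exact h.choose_spec

/-- Harmonic functions of an irreducible stochastic matrix are constant. -/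
theorem eq_of_mulVec_eq_self {Q : Matrix ι ι ℝ} (hQ : Q ∈ Matrix.rowStochastic ℝ ι)
    (hirr : Q.IsIrreducible) {v : ι → ℝ} (hv : Q *ᵥ v = v) (i j : ι) : v i = v j := by
  have hnn := fun i j => Matrix.nonneg_of_mem_rowStochastic hQ (i := i) (j := j)
  -- Maximum principle: `v m` is an average of `v` under `Q ^ k`, and every state is charged for
  -- some `k`.
  obtain ⟨m, -, hm⟩ := Finset.exists_max_image Finset.univ v ⟨i, Finset.mem_univ _⟩
  have key : ∀ j, v m = v j := by
    intro j
    obtain ⟨k, -, hk⟩ := (Matrix.isIrreducible_iff_exists_pow_pos hnn).mp hirr m j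
    have hQk : Q ^ k ∈ Matrix.rowStochastic ℝ ι := pow_mem hQ k
    have hvk : ∀ k : ℕ, Q ^ k *ᵥ v = v := by
      intro k
      induction k with
      | zero => simp
      | succ k ih => rw [pow_succ, ← Matrix.mulVec_mulVec, hv, ih]
    have h1 : ∑ l, (Q ^ k) m l * (v m - v l) = 0 := by
      simp_rw [mul_sub, Finset.sum_sub_distrib, ← Finset.sum_mul,
        Matrix.sum_row_of_mem_rowStochastic hQk m]
      have := congrFun (hvk k) m
      simp only [Matrix.mulVec, dotProduct] at this
      linarith
    have h2 := (Finset.sum_eq_zero_iff_of_nonneg fun l _ =>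
      mul_nonneg (Matrix.nonneg_of_mem_rowStochastic hQk)
        (sub_nonneg.mpr (hm l (Finset.mem_univ _)))).mp h1 j (Finset.mem_univ _)
    rcases mul_eq_zero.mp h2 with h | h
    · exact absurd h hk.ne'
    · linarith
  rw [← key i, ← key j]

/-- The Poisson equation `g - Q g = f - ρ(f)` of an irreducible chain is solvable. -/
theorem exists_poisson {Q : Matrix ι ι ℝ} (hQ : Q ∈ Matrix.rowStochastic ℝ ι)
    (hirr : Q.IsIrreducible) {ρ : ι → ℝ} (hρ : IsStationary Q ρ) (f : ι → ℝ) :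
    ∃ g : ι → ℝ, ∀ i, g i - (Q *ᵥ g) i = f i - ρ ⬝ᵥ f := by
  set A : (ι → ℝ) →ₗ[ℝ] (ι → ℝ) := (1 - Q).mulVecLin with hA
  have hAv : ∀ v, A v = v - Q *ᵥ v := fun v => by simp [hA]
  set ψ : (ι → ℝ) →ₗ[ℝ] ℝ := dotProductBilin ℝ ℝ ρ with hψ
  have hψv : ∀ v, ψ v = ρ ⬝ᵥ v := fun v => rfl
  have hρ1 : ρ ⬝ᵥ (1 : ι → ℝ) = 1 := by simpa [dotProduct] using hρ.1.2
  -- Fredholm alternative by counting dimensions: the kernel of `1 - Q` contains only constants, so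
  -- its range has codimension at most one and must fill the hyperplane `ρ(v) = 0`.
  have hle : LinearMap.range A ≤ LinearMap.ker ψ := by
    rintro _ ⟨v, rfl⟩
    rw [LinearMap.mem_ker, hψv, hAv, dotProduct_sub, Matrix.dotProduct_mulVec, hρ.2, sub_self]
  have hker : Module.finrank ℝ (LinearMap.ker A) ≤ 1 := by
    refine finrank_le_one (⟨1, ?_⟩ : LinearMap.ker A) ?_
    · rw [LinearMap.mem_ker, hAv, Matrix.one_vecMul_of_mem_rowStochastic hQ, sub_self]
    · rintro ⟨v, hv⟩
      rw [LinearMap.mem_ker, hAv, sub_eq_zero] at hv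
      refine ⟨ρ ⬝ᵥ v, Subtype.ext (funext fun i => ?_)⟩
      have hc : v = fun _ => v i :=
        funext fun j => eq_of_mulVec_eq_self hQ hirr hv.symm j i
      have : ρ ⬝ᵥ v = v i := by
        conv_lhs => rw [hc]
        simp [dotProduct, ← Finset.sum_mul, hρ.1.2]
      simp [this]
  have hrange : Module.finrank ℝ (LinearMap.range ψ) = 1 := by
    have : LinearMap.range ψ = ⊤ := LinearMap.range_eq_top.mpr fun c => ⟨c • 1, by
      rw [map_smul, hψv, hρ1, smul_eq_mul, mul_one]⟩
    rw [this]; simp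
  have h1 := A.finrank_range_add_finrank_ker
  have h2 := ψ.finrank_range_add_finrank_ker
  have heq : LinearMap.range A = LinearMap.ker ψ :=
    Submodule.eq_of_le_of_finrank_le hle (by omega)
  have hmem : (f - (ρ ⬝ᵥ f) • (1 : ι → ℝ)) ∈ LinearMap.ker ψ := by
    rw [LinearMap.mem_ker, hψv, dotProduct_sub, dotProduct_smul, hρ1]; simp
  rw [← heq] at hmem
  obtain ⟨g, hg⟩ := hmem
  refine ⟨g, fun i => ?_⟩
  have := congrFun hg i
  rw [hAv] at this
  simpa using this

end Stationary

/-! ### Exponential concentration of additive functionals -/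

section Concentration

variable {ι : Type*} [Fintype ι]

/-- The total weight of the paths of length `n` under a kernel with row sums at most `c`. -/
theorem sum_path_le {K : ι → ι → ℝ} (hK : ∀ x y, 0 ≤ K x y) {c : ℝ}
    (hc : ∀ x, ∑ y, K x y ≤ c) (n : ℕ) {ν : ι → ℝ} (hν : ∀ x, 0 ≤ ν x) :
    ∑ y : Fin (n + 1) → ι, ν (y 0) * ∏ s : Fin n, K (y s.castSucc) (y s.succ)
      ≤ (∑ x, ν x) * c ^ n := by
  induction n generalizing ν with
  | zero =>
    rw [← (Equiv.funUnique (Fin 1) ι).symm.sum_comp]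
    simp
  | succ n ih =>
    rw [← (Fin.consEquiv fun _ => ι).sum_comp, Fintype.sum_prod_type_right]
    have h1 : ∀ y : Fin (n + 1) → ι,
        ∑ x, ν ((Fin.consEquiv fun _ => ι) (x, y) 0) * ∏ s : Fin (n + 1),
          K ((Fin.consEquiv fun _ => ι) (x, y) s.castSucc)
            ((Fin.consEquiv fun _ => ι) (x, y) s.succ)
        = (∑ x, ν x * K x (y 0)) * ∏ s : Fin n, K (y s.castSucc) (y s.succ) := by
      intro y
      rw [Finset.sum_mul]
      refine Finset.sum_congr rfl fun x _ => ?_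
      rw [Fin.prod_univ_succ]
      simp [Fin.consEquiv, mul_assoc]
    simp_rw [h1]
    refine (ih (ν := fun y => ∑ x, ν x * K x y)
      fun y => Finset.sum_nonneg fun x _ => mul_nonneg (hν x) (hK x y)).trans ?_
    rw [Finset.sum_comm]
    simp_rw [← Finset.mul_sum]
    rcases isEmpty_or_nonempty ι with hι | ⟨⟨x₀⟩⟩
    · simp
    have hc0 : 0 ≤ c := (Finset.sum_nonneg fun y _ => hK x₀ y).trans (hc x₀)
    rw [pow_succ', ← mul_assoc, mul_comm _ c, Finset.mul_sum]
    refine mul_le_mul_of_nonneg_right (Finset.sum_le_sum fun x _ => ?_) (pow_nonneg hc0 n)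
    rw [mul_comm c]
    exact mul_le_mul_of_nonneg_left (hc x) (hν x)

variable {Ω : Type*} [MeasurableSpace Ω] {ℙ : Measure Ω} [IsProbabilityMeasure ℙ]
  {X : ℕ → Ω → ι} {ν : ι → ℝ} {Q : Matrix ι ι ℝ}

/-- Chernoff's bound for additive functionals of the transitions of a Markov chain. -/
theorem IsMarkovChain.chernoff (hX : IsMarkovChain ℙ X ν Q) (hν : ν ∈ stdSimplex ℝ ι)
    (hQ : ∀ x y, 0 ≤ Q x y) (D : ι → ι → ℝ) {c : ℝ}
    (hc : ∀ x, ∑ y, Q x y * Real.exp (D x y) ≤ c) (b : ℝ) (n : ℕ) :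
    ℙ.real {ω | b ≤ ∑ s ∈ Finset.range n, D (X s ω) (X (s + 1) ω)} ≤ Real.exp (-b) * c ^ n := by
  classical
  -- `law` takes infinite sequences but reads only the first `n + 1` entries, so a finite path is
  -- frozen after time `n`.
  let ext : (Fin (n + 1) → ι) → ℕ → ι := fun y t => y ⟨min t n, by omega⟩
  have hext0 : ∀ y, ext y 0 = y 0 := fun y => by simp [ext]
  have hextc : ∀ y (s : Fin n), ext y s = y s.castSucc := fun y s => by
    simp only [ext]; congr 1; ext; simp
  have hexts : ∀ y (s : Fin n), ext y (s + 1) = y s.succ := fun y s => by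
    simp only [ext]; congr 1; ext; simp
  let S : (ℕ → ι) → ℝ := fun x => ∑ s ∈ Finset.range n, D (x s) (x (s + 1))
  let bad : Finset (Fin (n + 1) → ι) := Finset.univ.filter fun y => b ≤ S (ext y)
  have hsub : {ω | b ≤ ∑ s ∈ Finset.range n, D (X s ω) (X (s + 1) ω)} ⊆
      ⋃ y ∈ bad, {ω | ∀ t ≤ n, X t ω = ext y t} := by
    intro ω hω
    have hagree : ∀ t ≤ n, X t ω = ext (fun k => X k ω) t := fun t ht => by
      simp [ext, min_eq_left ht]
    refine Set.mem_iUnion₂.mpr ⟨fun k => X k ω, ?_, hagree⟩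
    simp only [bad, Finset.mem_filter, Finset.mem_univ, true_and, S]
    refine le_of_le_of_eq hω (Finset.sum_congr rfl fun s hs => ?_)
    have := Finset.mem_range.mp hs
    rw [hagree s (by omega), hagree (s + 1) (by omega)]
  have hS : ∀ y, S (ext y) = ∑ s : Fin n, D (y s.castSucc) (y s.succ) := fun y => by
    simp only [S]
    rw [Finset.sum_range]
    exact Finset.sum_congr rfl fun s _ => by rw [hextc, hexts]
  have hterm : ∀ y ∈ bad, ℙ.real {ω | ∀ t ≤ n, X t ω = ext y t} ≤
      Real.exp (-b) * (ν (y 0) * ∏ s : Fin n,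
        (Q (y s.castSucc) (y s.succ) * Real.exp (D (y s.castSucc) (y s.succ)))) := by
    intro y hy
    have hy' : b ≤ S (ext y) := (Finset.mem_filter.mp hy).2
    rw [hX.law, Finset.prod_range, hext0, Finset.prod_mul_distrib, ← Real.exp_sum, ← hS]
    have h1 : ∏ s : Fin n, Q (ext y s) (ext y (s + 1)) =
        ∏ s : Fin n, Q (y s.castSucc) (y s.succ) :=
      Finset.prod_congr rfl fun s _ => by rw [hextc, hexts]
    rw [h1]
    have h2 : 0 ≤ ν (y 0) * ∏ s : Fin n, Q (y s.castSucc) (y s.succ) :=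
      mul_nonneg (hν.1 _) (Finset.prod_nonneg fun s _ => hQ _ _)
    have h3 : 1 ≤ Real.exp (-b) * Real.exp (S (ext y)) := by
      rw [← Real.exp_add]; exact Real.one_le_exp (by linarith)
    nlinarith [mul_le_mul_of_nonneg_left h3 h2]
  calc _ ≤ ℙ.real (⋃ y ∈ bad, {ω | ∀ t ≤ n, X t ω = ext y t}) := measureReal_mono hsub (measure_ne_top _ _)
    _ ≤ ∑ y ∈ bad, ℙ.real {ω | ∀ t ≤ n, X t ω = ext y t} := measureReal_biUnion_finset_le _ _
    _ ≤ ∑ y ∈ bad, Real.exp (-b) * (ν (y 0) * ∏ s : Fin n,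
        (Q (y s.castSucc) (y s.succ) * Real.exp (D (y s.castSucc) (y s.succ)))) :=
      Finset.sum_le_sum hterm
    _ ≤ ∑ y : Fin (n + 1) → ι, Real.exp (-b) * (ν (y 0) * ∏ s : Fin n,
        (Q (y s.castSucc) (y s.succ) * Real.exp (D (y s.castSucc) (y s.succ)))) := by
      refine Finset.sum_le_univ_sum_of_nonneg fun y => ?_
      have := hν.1 (y 0)
      have : 0 ≤ ∏ s : Fin n,
        (Q (y s.castSucc) (y s.succ) * Real.exp (D (y s.castSucc) (y s.succ))) :=
        Finset.prod_nonneg fun s _ => mul_nonneg (hQ _ _) (Real.exp_pos _).le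
      positivity
    _ ≤ Real.exp (-b) * c ^ n := by
      rw [← Finset.mul_sum]
      refine mul_le_mul_of_nonneg_left ?_ (Real.exp_pos _).le
      have := sum_path_le (K := fun x y => Q x y * Real.exp (D x y))
        (fun x y => mul_nonneg (hQ x y) (Real.exp_pos _).le) hc n hν.1
      rwa [hν.2, one_mul] at this

variable [DecidableEq ι]

/-- Additive functionals of the transitions of an irreducible chain exceed their stationary mean
by a linear amount only with exponentially small probability. -/
theorem IsMarkovChain.concentration (hX : IsMarkovChain ℙ X ν Q) (hν : ν ∈ stdSimplex ℝ ι)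
    (hQ : Q ∈ Matrix.rowStochastic ℝ ι) (hirr : Q.IsIrreducible) {ρ : ι → ℝ}
    (hρ : IsStationary Q ρ) (f : ι → ι → ℝ) {δ : ℝ} (hδ : 0 < δ) :
    ∃ C r : ℝ, 0 ≤ C ∧ 0 ≤ r ∧ r < 1 ∧ ∀ n : ℕ,
      ℙ.real {ω | n * (∑ i, ρ i * ∑ j, Q i j * f i j + δ) ≤
        ∑ s ∈ Finset.range n, f (X s ω) (X (s + 1) ω)} ≤ C * r ^ n := by
  have hnn : ∀ i j, 0 ≤ Q i j := fun i j => Matrix.nonneg_of_mem_rowStochastic hQ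
  have hrow := fun i => Matrix.sum_row_of_mem_rowStochastic hQ i
  set a := ∑ i, ρ i * ∑ j, Q i j * f i j with ha
  obtain ⟨g, hg⟩ := exists_poisson hQ hirr hρ fun i => ∑ j, Q i j * f i j
  -- Adding the increment of the Poisson solution `g` makes every conditional mean zero; along a
  -- path the correction telescopes.
  let D : ι → ι → ℝ := fun x y => f x y - a + g y - g x
  have hD0 : ∀ x, ∑ y, Q x y * D x y = 0 := by
    intro x
    have h1 := hg x
    simp only [Matrix.mulVec, dotProduct, ← ha] at h1
    have h2 : ∀ y, Q x y * D x y = Q x y * f x y + Q x y * g y - Q x y * (a + g x) :=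
      fun y => by simp only [D]; ring
    simp_rw [h2, Finset.sum_sub_distrib, Finset.sum_add_distrib, ← Finset.sum_mul, hrow]
    linarith
  obtain ⟨B₁, hB₁⟩ := (Set.finite_range fun z : ι × ι => |D z.1 z.2|).bddAbove
  obtain ⟨G, hG⟩ := (Set.finite_range fun z : ι × ι => |g z.1 - g z.2|).bddAbove
  set B := max B₁ 1
  have hB1 : 1 ≤ B := le_max_right _ _
  have hDB : ∀ x y, |D x y| ≤ B := fun x y => (hB₁ ⟨(x, y), rfl⟩).trans (le_max_left _ _)
  -- From `exp u ≤ 1 + u + u²` for `|u| ≤ 1`, the exponential moment per step is at most `exp (l²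
  -- B²)`. This `l` makes `l² B² ≤ l δ / 2`; the cutoffs `B ≥ 1` and `min δ 1` ensure `l B ≤ 1`.
  set l := min δ 1 / (2 * B ^ 2) with hl
  have hmin : 0 < min δ 1 := lt_min hδ one_pos
  have hl0 : 0 < l := by positivity
  have hlB2 : l * B ^ 2 = min δ 1 / 2 := by rw [hl]; field_simp
  have hlB : l * B ≤ 1 := by
    have : l * B ≤ l * B ^ 2 := by gcongr; nlinarith
    have := min_le_right δ 1
    linarith
  have hlD : ∀ x, ∑ y, Q x y * Real.exp (l * D x y) ≤ Real.exp (l * (l * B ^ 2)) := by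
    intro x
    have h1 : ∀ y ∈ Finset.univ, Q x y * Real.exp (l * D x y) ≤
        Q x y * (1 + l * (l * B ^ 2)) + l * (Q x y * D x y) := by
      intro y _
      have h2 : |l * D x y| ≤ l * B := by
        rw [abs_mul, abs_of_pos hl0]; exact mul_le_mul_of_nonneg_left (hDB x y) hl0.le
      have h3 := (abs_le.mp (Real.abs_exp_sub_one_sub_id_le (h2.trans hlB))).2
      have h4 : (l * D x y) ^ 2 ≤ (l * B) ^ 2 := sq_le_sq' (by linarith [(abs_le.mp h2).1])
        (abs_le.mp h2).2
      have h5 : Real.exp (l * D x y) ≤ 1 + l * (l * B ^ 2) + l * D x y := by nlinarith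
      nlinarith [mul_le_mul_of_nonneg_left h5 (hnn x y)]
    refine (Finset.sum_le_sum h1).trans ?_
    rw [Finset.sum_add_distrib, ← Finset.sum_mul, ← Finset.mul_sum, hrow, hD0]
    linarith [Real.add_one_le_exp (l * (l * B ^ 2))]
  refine ⟨Real.exp (l * G), Real.exp (l * (l * B ^ 2) - l * δ), (Real.exp_pos _).le,
    (Real.exp_pos _).le, ?_, fun n => ?_⟩
  · rw [Real.exp_lt_one_iff, ← mul_sub, hlB2]
    have := min_le_left δ 1
    exact mul_neg_of_pos_of_neg hl0 (by linarith)
  -- The threshold loses `G`, a bound on the telescoped term `g (X n) - g (X 0)`.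
  · refine (measureReal_mono ?_).trans
      ((hX.chernoff hν hnn (fun x y => l * D x y) hlD (l * (n * δ - G)) n).trans_eq ?_)
    · intro ω hω
      simp only [Set.mem_ofPred_eq] at hω ⊢
      rw [← Finset.mul_sum]
      refine mul_le_mul_of_nonneg_left ?_ hl0.le
      have h1 : ∑ s ∈ Finset.range n, D (X s ω) (X (s + 1) ω) =
          ∑ s ∈ Finset.range n, f (X s ω) (X (s + 1) ω) - n * a + (g (X n ω) - g (X 0 ω)) := by
        rw [← Finset.sum_range_sub (fun s => g (X s ω))]
        simp only [D, add_sub_assoc, Finset.sum_add_distrib, Finset.sum_sub_distrib,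
          Finset.sum_const, Finset.card_range, nsmul_eq_mul]
      have h2 := (abs_le.mp (hG ⟨(X n ω, X 0 ω), rfl⟩ : |g (X n ω) - g (X 0 ω)| ≤ G)).1
      rw [h1]
      linarith
    · rw [← Real.exp_nat_mul, ← Real.exp_nat_mul, ← Real.exp_add, ← Real.exp_add]
      congr 1; ring

end Concentration

/-! ### Variational formula for the Kullback-Leibler divergence -/

section Duality

variable {ι : Type*} [Fintype ι]

/-- The dual functional `∑ⱼ qⱼ hⱼ - ∑ⱼ pⱼ exp hⱼ + 1`, whose supremum over `h` is `KL(q, p)`. -/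
noncomputable def klDual (q p h : ι → ℝ) : ℝ :=
  ∑ j, q j * h j - ∑ j, p j * Real.exp (h j) + 1

theorem klDual_zero {q p : ι → ℝ} (hp : p ∈ stdSimplex ℝ ι) : klDual q p 0 = 0 := by
  simp [klDual, hp.2]

/-- Weak duality, termwise from `log u ≤ u - 1` at `u = p e^h / q`. -/
theorem ofReal_klDual_le_kl {q p : ι → ℝ} (hq : q ∈ stdSimplex ℝ ι) (hp : p ∈ stdSimplex ℝ ι)
    (h : ι → ℝ) : ENNReal.ofReal (klDual q p h) ≤ kl q p := by
  unfold kl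
  split_ifs with hqp
  · refine ENNReal.ofReal_le_ofReal ?_
    have key : ∀ j ∈ Finset.univ,
        q j * h j - p j * Real.exp (h j) + q j ≤ q j * Real.log (q j / p j) := by
      intro j _
      rcases (hq.1 j).eq_or_lt with h0 | h0
      · rw [← h0]
        have := mul_nonneg (hp.1 j) (Real.exp_pos (h j)).le
        simpa using this
      · have hpj : 0 < p j := lt_of_le_of_ne (hp.1 j) fun e => h0.ne' (hqp j e.symm)
        have h1 := Real.log_le_sub_one_of_pos
          (div_pos (mul_pos hpj (Real.exp_pos (h j))) h0)
        rw [Real.log_div (by positivity) h0.ne', Real.log_mul hpj.ne' (Real.exp_pos _).ne',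
          Real.log_exp] at h1
        rw [Real.log_div h0.ne' hpj.ne']
        have h2 := mul_le_mul_of_nonneg_left h1 h0.le
        have h3 : q j * (p j * Real.exp (h j) / q j - 1) = p j * Real.exp (h j) - q j := by
          field_simp
        linarith
    have := Finset.sum_le_sum key
    rw [Finset.sum_add_distrib, Finset.sum_sub_distrib, hq.2] at this
    exact this
  · exact le_top

/-- The formal optimizer `log (q / p)` may be undefined; shifting both vectors by `ε` keeps it
finite and still attains the supremum in the limit, including the value `∞`. -/
theorem tendsto_ofReal_klDual {q p : ι → ℝ} (hq : q ∈ stdSimplex ℝ ι) (hp : p ∈ stdSimplex ℝ ι) :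
    Tendsto (fun ε : ℝ => ENNReal.ofReal
      (klDual q p fun j => Real.log ((q j + ε) / (p j + ε)))) (𝓝[>] 0) (𝓝 (kl q p)) := by
  classical
  set T : ℝ → ℝ := fun ε => ∑ j, q j * Real.log ((q j + ε) / (p j + ε)) with hT
  have hid : Tendsto (fun ε : ℝ => ε) (𝓝[>] 0) (𝓝 0) := tendsto_nhdsWithin_of_tendsto_nhds tendsto_id
  have hlow : ∀ᶠ ε in 𝓝[>] (0 : ℝ),
      T ε - Fintype.card ι * ε ≤ klDual q p fun j => Real.log ((q j + ε) / (p j + ε)) := by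
    filter_upwards [self_mem_nhdsWithin] with ε (hε : 0 < ε)
    have h1 : ∑ j, p j * Real.exp (Real.log ((q j + ε) / (p j + ε))) ≤ ∑ j, (q j + ε) := by
      refine Finset.sum_le_sum fun j _ => ?_
      have h2 := hq.1 j
      have h3 := hp.1 j
      rw [Real.exp_log (by positivity), mul_div_assoc', div_le_iff₀ (by positivity)]
      nlinarith
    rw [Finset.sum_add_distrib, hq.2, Finset.sum_const, Finset.card_univ, nsmul_eq_mul] at h1
    simp only [klDual, hT]
    linarith
  have hcard : Tendsto (fun ε : ℝ => (Fintype.card ι : ℝ) * ε) (𝓝[>] 0) (𝓝 0) := by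
    simpa using hid.const_mul (Fintype.card ι : ℝ)
  have hterm : ∀ j, p j ≠ 0 → Tendsto (fun ε => q j * Real.log ((q j + ε) / (p j + ε))) (𝓝[>] 0)
      (𝓝 (q j * Real.log (q j / p j))) := by
    intro j hpj
    rcases eq_or_ne (q j) 0 with h0 | h0
    · simp [h0]
    refine Tendsto.const_mul _ (Tendsto.log ?_ (div_ne_zero h0 hpj))
    have := (hid.const_add (q j)).div (hid.const_add (p j)) (by simpa using hpj)
    rw [add_zero, add_zero] at this
    exact this
  by_cases hqp : ∀ j, p j = 0 → q j = 0
  · have hkl : kl q p = ENNReal.ofReal (∑ j, q j * Real.log (q j / p j)) := by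
      rw [kl, if_pos hqp]
    have hTlim : Tendsto T (𝓝[>] 0) (𝓝 (∑ j, q j * Real.log (q j / p j))) := by
      refine tendsto_finsetSum _ fun j _ => ?_
      by_cases hpj : p j = 0
      · simp [hqp j hpj]
      · exact hterm j hpj
    refine tendsto_of_tendsto_of_tendsto_of_le_of_le'
      (g := fun ε => ENNReal.ofReal (T ε - Fintype.card ι * ε)) ?_ tendsto_const_nhds
      (hlow.mono fun ε hε => ENNReal.ofReal_le_ofReal hε)
      (Eventually.of_forall fun ε => ofReal_klDual_le_kl hq hp _)
    rw [hkl]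
    refine ENNReal.tendsto_ofReal ?_
    simpa using hTlim.sub hcard
  · have hkl : kl q p = ⊤ := by rw [kl, if_neg hqp]
    push Not at hqp
    obtain ⟨j₀, hp0, hq0⟩ := hqp
    have hq0' : 0 < q j₀ := lt_of_le_of_ne (hq.1 j₀) hq0.symm
    rw [hkl, ENNReal.tendsto_ofReal_nhds_top]
    refine tendsto_atTop_mono' _ hlow ?_
    have hj₀ : Tendsto (fun ε => q j₀ * Real.log ((q j₀ + ε) / (p j₀ + ε))) (𝓝[>] 0) atTop := by
      refine Tendsto.const_mul_atTop hq0' (Real.tendsto_log_atTop.comp ?_)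
      simp_rw [hp0, zero_add, div_eq_mul_inv]
      have := hid.const_add (q j₀)
      rw [add_zero] at this
      exact this.pos_mul_atTop hq0' tendsto_inv_nhdsGT_zero
    -- The other terms stay bounded below because `p j + ε ≤ 2`, so they cannot offset the
    -- divergence at `j₀`.
    have hrest : ∀ᶠ ε in 𝓝[>] (0 : ℝ),
        ∑ j ∈ Finset.univ.erase j₀, -|q j * Real.log (q j / 2)| ≤
        ∑ j ∈ Finset.univ.erase j₀, q j * Real.log ((q j + ε) / (p j + ε)) := by
      filter_upwards [Ioc_mem_nhdsGT (zero_lt_one' ℝ)] with ε hε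
      refine Finset.sum_le_sum fun j _ => (neg_abs_le _).trans ?_
      rcases (hq.1 j).eq_or_lt with h0 | h0
      · simp [← h0]
      have h1 : p j ≤ 1 := hp.2 ▸ Finset.single_le_sum (fun i _ => hp.1 i) (Finset.mem_univ j)
      have h2 := hp.1 j
      have h3 := hε.1
      have h4 := hε.2
      gcongr <;> linarith
    have hTtop : Tendsto T (𝓝[>] 0) atTop := by
      have := tendsto_atTop_add_right_of_le' _ _ hj₀ hrest
      refine this.congr fun ε => ?_
      exact Finset.add_sum_erase _ (fun j => q j * Real.log ((q j + ε) / (p j + ε)))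
        (Finset.mem_univ j₀)
    have := hTtop.atTop_add hcard.neg
    simpa [sub_eq_add_neg] using this

end Duality

/-! ### Linear growth of the statistic near the stationary frequencies -/

section LowerBound

variable {ι : Type*} [Fintype ι]

/-- The dual functional of the weighted divergence, as a function of unnormalized transition
frequencies `w`. -/
noncomputable def transitionDual (h w : ι → ι → ℝ) (P : Matrix ι ι ℝ) : ℝ :=
  ∑ i, (∑ j, w i j * h i j - (∑ j, w i j) * ∑ j, P i j * Real.exp (h i j) + ∑ j, w i j)

theorem continuous_transitionDual (h : ι → ι → ℝ) :
    Continuous fun z : (ι → ι → ℝ) × Matrix ι ι ℝ => transitionDual h z.1 z.2 := by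
  unfold transitionDual
  have h1 : ∀ i j, Continuous fun z : (ι → ι → ℝ) × Matrix ι ι ℝ => z.1 i j := fun i j => by
    fun_prop
  have h2 : ∀ i j, Continuous fun z : (ι → ι → ℝ) × Matrix ι ι ℝ => z.2 i j := fun i j =>
    continuous_snd.matrix_elem i j
  fun_prop

/-- Serves both the stationary weights and the empirical ones. Rows of weight zero need no
normalization, so unvisited states do no harm. -/
theorem transitionDual_eq {w q : ι → ι → ℝ} {n : ι → ℝ} (hq : ∀ i, n i ≠ 0 → ∑ j, q i j = 1)
    (hw : ∀ i j, w i j = n i * q i j) (h : ι → ι → ℝ) (P : Matrix ι ι ℝ) :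
    transitionDual h w P = ∑ i, n i * klDual (q i) (P i) (h i) := by
  refine Finset.sum_congr rfl fun i _ => ?_
  simp_rw [hw, mul_assoc, ← Finset.mul_sum, klDual]
  by_cases hi : n i = 0
  · simp [hi]
  · rw [hq i hi]; ring

variable [DecidableEq ι]

theorem row_mem_stdSimplex {P : Matrix ι ι ℝ} (hP : P ∈ Matrix.rowStochastic ℝ ι) (i : ι) :
    P i ∈ stdSimplex ℝ ι :=
  ⟨fun _ => Matrix.nonneg_of_mem_rowStochastic hP, Matrix.sum_row_of_mem_rowStochastic hP i⟩

/-- The weighted divergence is a supremum of its dual functionals. -/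
theorem exists_lt_transitionDual {Q P : Matrix ι ι ℝ} (hQ : Q ∈ Matrix.rowStochastic ℝ ι)
    (hP : P ∈ Matrix.rowStochastic ℝ ι) {ρ : ι → ℝ} (hρ : ∀ i, 0 ≤ ρ i) {c : ℝ} (hc : 0 ≤ c)
    (h : ENNReal.ofReal c < ∑ i, ENNReal.ofReal (ρ i) * kl (Q i) (P i)) :
    ∃ g : ι → ι → ℝ, c < transitionDual g (fun i j => ρ i * Q i j) P := by
  have hlim : Tendsto (fun ε : ℝ => ∑ i, ENNReal.ofReal (ρ i) * ENNReal.ofReal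
      (klDual (Q i) (P i) fun j => Real.log ((Q i j + ε) / (P i j + ε)))) (𝓝[>] 0)
      (𝓝 (∑ i, ENNReal.ofReal (ρ i) * kl (Q i) (P i))) :=
    tendsto_finsetSum _ fun i _ => ENNReal.Tendsto.const_mul
      (tendsto_ofReal_klDual (row_mem_stdSimplex hQ i) (row_mem_stdSimplex hP i))
      (Or.inr ENNReal.ofReal_ne_top)
  obtain ⟨ε, hε⟩ := (hlim.eventually (lt_mem_nhds h)).exists
  classical
  let g₀ : ι → ι → ℝ := fun i j => Real.log ((Q i j + ε) / (P i j + ε))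
  -- Rows with a negative dual value are reset to `h = 0`, whose value is `0`; this matches the
  -- truncation by `ENNReal.ofReal`.
  refine ⟨fun i => if 0 ≤ klDual (Q i) (P i) (g₀ i) then g₀ i else 0, ?_⟩
  rw [transitionDual_eq (fun i _ => Matrix.sum_row_of_mem_rowStochastic hQ i) (fun _ _ => rfl)]
  have h1 : ∀ i, klDual (Q i) (P i) (if 0 ≤ klDual (Q i) (P i) (g₀ i) then g₀ i else 0) =
      max (klDual (Q i) (P i) (g₀ i)) 0 := by
    intro i
    split_ifs with hi
    · rw [max_eq_left hi]
    · rw [klDual_zero (row_mem_stdSimplex hP i), max_eq_right (not_le.mp hi).le]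
  simp_rw [h1]
  refine (ENNReal.ofReal_lt_ofReal_iff_of_nonneg hc).mp (hε.trans_eq ?_)
  rw [ENNReal.ofReal_sum_of_nonneg fun i _ => mul_nonneg (hρ i) (le_max_right _ _)]
  refine Finset.sum_congr rfl fun i _ => ?_
  rw [ENNReal.ofReal_mul (hρ i)]
  congr 1
  rw [ENNReal.ofReal_max]
  simp [g₀]

theorem sum_transitions (x : ℕ → ι) (t : ℕ) (i : ι) :
    ∑ j, transitions x t i j = visits x t i := by
  simp only [transitions, visits, ← Finset.filter_filter]
  exact (Finset.card_eq_sum_card_fiberwise fun s _ => Finset.mem_univ (x (s + 1))).symm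

theorem empirical_mem_stdSimplex {x : ℕ → ι} {t : ℕ} {i : ι} (hi : 0 < visits x t i) :
    empirical x t i ∈ stdSimplex ℝ ι := by
  have h : ∀ j, empirical x t i j = (transitions x t i j : ℝ) / visits x t i := fun j => by
    simp [empirical, hi]
  refine ⟨fun j => by rw [h]; positivity, ?_⟩
  simp_rw [h, ← Finset.sum_div, ← Nat.cast_sum, sum_transitions]
  exact div_self (by positivity)

theorem ofReal_transitionDual_le (x : ℕ → ι) {t : ℕ} (ht : 1 ≤ t) {P : Matrix ι ι ℝ}
    (hP : P ∈ Matrix.rowStochastic ℝ ι) (h : ι → ι → ℝ) :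
    ENNReal.ofReal (t * transitionDual h (fun i j => (transitions x t i j : ℝ) / t) P) ≤
      ∑ i ∈ Finset.univ.filter (fun i => 0 < visits x t i),
        (visits x t i : ℝ≥0∞) * kl (empirical x t i) (P i) := by
  have ht0 : (t : ℝ) ≠ 0 := by positivity
  have hvis : ∀ i, ¬ 0 < visits x t i → ∀ j, transitions x t i j = 0 := fun i hi j => by
    have h1 := Finset.single_le_sum (f := fun j => transitions x t i j)
      (fun _ _ => Nat.zero_le _) (Finset.mem_univ j)
    rw [sum_transitions] at h1
    omega
  rw [transitionDual_eq (n := fun i => (visits x t i : ℝ) / t) (q := empirical x t)]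
  · rw [Finset.mul_sum]
    have hsum : ∑ i, (t : ℝ) * ((visits x t i : ℝ) / t * klDual (empirical x t i) (P i) (h i)) =
        ∑ i ∈ Finset.univ.filter (fun i => 0 < visits x t i),
          (visits x t i : ℝ) * klDual (empirical x t i) (P i) (h i) := by
      rw [Finset.sum_filter]
      refine Finset.sum_congr rfl fun i _ => ?_
      split_ifs with hi
      · field_simp
      · simp [Nat.eq_zero_of_not_pos hi]
    rw [hsum]
    refine (Finset.le_sum_of_subadditive ENNReal.ofReal ENNReal.ofReal_zero.le
      (fun _ _ => ENNReal.ofReal_add_le) _ _).trans (Finset.sum_le_sum fun i hi => ?_)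
    rw [ENNReal.ofReal_mul (Nat.cast_nonneg _), ENNReal.ofReal_natCast]
    exact mul_le_mul_right (ofReal_klDual_le_kl
      (empirical_mem_stdSimplex (Finset.mem_filter.mp hi).2) (row_mem_stdSimplex hP i) _) _
  · intro i hi
    have : 0 < visits x t i := Nat.pos_of_ne_zero fun h0 => hi (by simp [h0])
    exact (empirical_mem_stdSimplex this).2
  · intro i j
    by_cases hi : 0 < visits x t i
    · simp only [empirical, Matrix.of_apply, if_pos hi]
      field_simp
    · simp [hvis i hi, Nat.eq_zero_of_not_pos hi]

/-- If the empirical transition frequencies are close to the stationary ones, then the statistic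
grows at least at any rate below the infimum of the stationary divergence. -/
theorem exists_statistic_lower_bound {Q : Matrix ι ι ℝ} (hQ : Q ∈ Matrix.rowStochastic ℝ ι)
    (hρ : ∀ i, 0 ≤ stationaryDist Q i) {H₀ : Set (Matrix ι ι ℝ)} (hH : IsCompact H₀)
    (hH' : ∀ P ∈ H₀, P ∈ Matrix.rowStochastic ℝ ι) {c : ℝ} (hc : 0 ≤ c)
    (hcD : ENNReal.ofReal c < infStationaryKL Q H₀) :
    ∃ δ > 0, ∀ (x : ℕ → ι) (t : ℕ), 1 ≤ t →
      (∀ i j, |(transitions x t i j : ℝ) / t - stationaryDist Q i * Q i j| < δ) →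
      ENNReal.ofReal (t * c) ≤ statistic H₀ x t := by
  -- The witness `g` may depend on `P`; compactness makes only the neighbourhood of `w` uniform,
  -- which is all the infimum over `P` needs.
  have hev : ∀ᶠ w in 𝓝 (fun i j => stationaryDist Q i * Q i j), ∀ P ∈ H₀,
      ∃ g : ι → ι → ℝ, c < transitionDual g w P := by
    refine hH.eventually_forall_of_forall_eventually fun P hP => ?_
    have hle : infStationaryKL Q H₀ ≤ stationaryKL Q P :=
      iInf₂_le (f := fun P (_ : P ∈ H₀) => stationaryKL Q P) P hP
    obtain ⟨g, hg⟩ := exists_lt_transitionDual hQ (hH' P hP) hρ hc (hcD.trans_le hle)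
    have hopen : IsOpen {z : (ι → ι → ℝ) × Matrix ι ι ℝ | c < transitionDual g z.1 z.2} :=
      isOpen_lt continuous_const (continuous_transitionDual g)
    filter_upwards [hopen.mem_nhds (x := (fun i j => stationaryDist Q i * Q i j, P)) hg]
      with z hz
    exact ⟨g, hz⟩
  obtain ⟨δ, hδ, hball⟩ := Metric.eventually_nhds_iff.mp hev
  refine ⟨δ, hδ, fun x t ht hx => ?_⟩
  unfold statistic
  refine le_iInf₂ fun P hP => ?_
  have hdist : dist (fun i j => (transitions x t i j : ℝ) / t)
      (fun i j => stationaryDist Q i * Q i j) < δ := by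
    refine (dist_pi_lt_iff hδ).mpr fun i => (dist_pi_lt_iff hδ).mpr fun j => ?_
    rw [Real.dist_eq]
    exact hx i j
  obtain ⟨g, hg⟩ := hball hdist P hP
  refine le_trans (ENNReal.ofReal_le_ofReal ?_) (ofReal_transitionDual_le x ht (hH' P hP) g)
  exact mul_le_mul_of_nonneg_left hg.le (Nat.cast_nonneg _)

end LowerBound

/-! ### Expected stopping time and its asymptotics -/

section StoppingTime

variable {ι : Type*} [DecidableEq ι]

theorem visits_le (x : ℕ → ι) (t : ℕ) (i : ι) : visits x t i ≤ t := by
  simpa [visits] using Finset.card_filter_le (Finset.range t) (fun s => x s = i)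

theorem transitions_eq_sum (x : ℕ → ι) (t : ℕ) (i j : ι) :
    (transitions x t i j : ℝ) =
      ∑ s ∈ Finset.range t, if x s = i ∧ x (s + 1) = j then (1 : ℝ) else 0 := by
  simp [transitions]

variable [Fintype ι]

theorem boundary_le [Nonempty ι] (α : ℝ) (x : ℕ → ι) (t : ℕ) :
    boundary α x t ≤ Real.log (1 / α) +
      ((Fintype.card ι : ℝ) - 1) * (Fintype.card ι * (1 + Real.log (1 + t))) := by
  unfold boundary psi
  have hcard : 1 ≤ Fintype.card ι := Fintype.card_pos
  have hm : (0 : ℝ) ≤ (Fintype.card ι : ℝ) - 1 := by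
    rw [sub_nonneg]; exact_mod_cast hcard
  gcongr
  rw [← nsmul_eq_mul]
  refine Finset.sum_le_card_nsmul Finset.univ _ _ fun i _ => ?_
  have h0 : (0 : ℝ) ≤ (visits x t i : ℝ) / ((Fintype.card ι : ℝ) - 1) := by positivity
  rw [Real.log_mul (Real.exp_pos _).ne' (by positivity), Real.log_exp]
  have hv : (visits x t i : ℝ) / ((Fintype.card ι : ℝ) - 1) ≤ t := by
    -- With a single state the quotient is a division by zero, hence `0`.
    rcases hcard.eq_or_lt with h | h
    · simp [← h]
    · have h2 : (1 : ℝ) ≤ (Fintype.card ι : ℝ) - 1 := by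
        have : (2 : ℝ) ≤ Fintype.card ι := by exact_mod_cast h
        linarith
      exact (div_le_self (Nat.cast_nonneg _) h2).trans (by exact_mod_cast visits_le x t i)
  gcongr

/-- The boundary exceeds `log (1/α)` by a sublinear amount. -/
theorem exists_boundary_le [Nonempty ι] {η : ℝ} (hη : 0 < η) :
    ∃ T₀ : ℕ, ∀ t ≥ T₀, ∀ (α : ℝ) (x : ℕ → ι), boundary α x t ≤ Real.log (1 / α) + η * t := by
  have h1 : (fun t : ℕ => ((Fintype.card ι : ℝ) - 1) *
      (Fintype.card ι * (1 + Real.log (1 + t)))) =o[atTop] fun t : ℕ => (1 + t : ℝ) := by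
    have htop : Tendsto (fun t : ℕ => (1 + t : ℝ)) atTop atTop :=
      tendsto_atTop_add_const_left _ _ tendsto_natCast_atTop_atTop
    have hlog : (fun t : ℕ => Real.log (1 + t)) =o[atTop] fun t : ℕ => (1 + t : ℝ) :=
      Real.isLittleO_log_id_atTop.comp_tendsto htop
    have hone : (fun _ : ℕ => (1 : ℝ)) =o[atTop] fun t : ℕ => (1 + t : ℝ) :=
      (Asymptotics.isLittleO_const_id_atTop (1 : ℝ)).comp_tendsto htop
    exact ((hone.add hlog).const_mul_left _).const_mul_left _
  obtain ⟨T₀, hT₀⟩ := eventually_atTop.mp (h1.bound (half_pos hη))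
  -- For `t ≥ 1` one has `(η / 2) (1 + t) ≤ η t`.
  refine ⟨max T₀ 1, fun t ht α x => (boundary_le α x t).trans ?_⟩
  have h2 := (le_abs_self _).trans (hT₀ t (le_trans (le_max_left _ _) ht))
  have h3 : (1 : ℝ) ≤ t := by exact_mod_cast le_trans (le_max_right _ _) ht
  rw [Real.norm_of_nonneg (by positivity)] at h2
  nlinarith

/-- A first hitting time is at most `T` plus the number of later times that are not hitting
times. -/
theorem iInf_natCast_le_add_tsum (good : ℕ → Prop) (bad : Set ℕ) (T : ℕ)
    (h : ∀ t ≥ T, t ∉ bad → good t) :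
    (((⨅ (t : ℕ) (_ : good t), (t : ℕ∞)) : ℕ∞) : ℝ≥0∞) ≤
      T + ∑' t, bad.indicator (fun _ => (1 : ℝ≥0∞)) t := by
  classical
  have hmem : ∀ n, (∀ t, T ≤ t → t < n → t ∈ bad) →
      ((n - T : ℕ) : ℝ≥0∞) ≤ ∑' t, bad.indicator (fun _ => (1 : ℝ≥0∞)) t := by
    intro n hn
    refine le_trans (le_of_eq ?_) (ENNReal.sum_le_tsum (Finset.Ico T n))
    rw [Finset.sum_congr rfl fun t ht => Set.indicator_of_mem
      (hn t (Finset.mem_Ico.mp ht).1 (Finset.mem_Ico.mp ht).2) _]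
    simp
  -- The first time `n ≥ T` outside `bad` is a hitting time, and all of `T, …, n - 1` are bad. If
  -- there is no such `n`, the sum is infinite.
  by_cases hex : ∃ t, T ≤ t ∧ t ∉ bad
  · obtain ⟨h1, h2⟩ := Nat.find_spec hex
    set n := Nat.find hex
    have h3 := hmem n fun t ht htn => by
      by_contra hb
      exact Nat.find_min hex htn ⟨ht, hb⟩
    have h4 : (⨅ (t : ℕ) (_ : good t), (t : ℕ∞)) ≤ (n : ℕ∞) := iInf₂_le n (h n h1 h2)
    calc _ ≤ (((n : ℕ∞)) : ℝ≥0∞) := ENat.toENNReal_le.mpr h4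
      _ = (T : ℝ≥0∞) + ((n - T : ℕ) : ℝ≥0∞) := by
        rw [ENat.toENNReal_coe, ← Nat.cast_add]; congr 1; omega
      _ ≤ _ := by gcongr
  · push Not at hex
    have : ∑' t, bad.indicator (fun _ => (1 : ℝ≥0∞)) t = ⊤ := by
      refine ENNReal.eq_top_of_forall_nnreal_le fun r => ?_
      obtain ⟨n, hn⟩ := exists_nat_ge r
      have := hmem (n + T) fun t ht _ => hex t ht
      rw [Nat.add_sub_cancel] at this
      exact le_trans (by exact_mod_cast hn) this
    rw [this]; simp

variable {Ω : Type*} [MeasurableSpace Ω] {ℙ : Measure Ω} [IsProbabilityMeasure ℙ]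
  {X : ℕ → Ω → ι} {ν : ι → ℝ} {Q : Matrix ι ι ℝ}

/-- The event that some transition frequency at time `t` is `δ`-far from its stationary value. -/
def frequencyDeviation (X : ℕ → Ω → ι) (w : ι → ι → ℝ) (δ : ℝ) (t : ℕ) : Set Ω :=
  {ω | ∃ i j, δ ≤ |(transitions (fun s => X s ω) t i j : ℝ) / t - w i j|}

/-- The expected number of times at which some transition frequency is far from its stationary
value is finite. -/
theorem IsMarkovChain.tsum_frequencyDeviation_ne_top (hX : IsMarkovChain ℙ X ν Q)
    (hν : ν ∈ stdSimplex ℝ ι) (hQ : Q ∈ Matrix.rowStochastic ℝ ι) (hirr : Q.IsIrreducible)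
    {ρ : ι → ℝ} (hρ : IsStationary Q ρ) {δ : ℝ} (hδ : 0 < δ) :
    ∑' t, ℙ (frequencyDeviation X (fun i j => ρ i * Q i j) δ t) ≠ ⊤ := by
  have hmean : ∀ (i j : ι) (σ : ℝ), ∑ a, ρ a * ∑ b, Q a b *
      (σ * if a = i ∧ b = j then (1 : ℝ) else 0) = σ * (ρ i * Q i j) := by
    intro i j σ
    rw [Finset.sum_eq_single i (fun a _ ha => by simp [ha]) (by simp),
      Finset.sum_eq_single j (fun b _ hb => by simp [hb]) (by simp)]
    simp; ring
  -- The Boolean is the sign of the deviation, since concentration is one-sided.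
  let E : (ι × ι) × Bool → ℕ → Set Ω := fun z t => {ω |
    t * ((if z.2 then (1 : ℝ) else -1) * (ρ z.1.1 * Q z.1.1 z.1.2) + δ) ≤
      (if z.2 then (1 : ℝ) else -1) * transitions (fun s => X s ω) t z.1.1 z.1.2}
  have hE : ∀ z, ∑' t, ℙ (E z t) ≠ ⊤ := by
    intro z
    obtain ⟨C, r, hC, hr0, hr1, hb⟩ := hX.concentration hν hQ hirr hρ
      (fun a b => (if z.2 then (1 : ℝ) else -1) *
        if a = z.1.1 ∧ b = z.1.2 then (1 : ℝ) else 0) hδ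
    rw [hmean] at hb
    have hsummable : Summable fun t : ℕ => C * r ^ t :=
      (summable_geometric_of_lt_one hr0 hr1).mul_left C
    refine ne_top_of_le_ne_top hsummable.tsum_ofReal_ne_top (ENNReal.tsum_le_tsum fun t => ?_)
    refine (ENNReal.le_ofReal_iff_toReal_le (measure_ne_top _ _) (by positivity)).mpr ?_
    refine le_trans (le_of_eq ?_) (hb t)
    simp only [E, transitions_eq_sum, Finset.mul_sum, measureReal_def]
  have hsub : ∀ t ≥ 1, frequencyDeviation X (fun i j => ρ i * Q i j) δ t ⊆ ⋃ z, E z t := by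
    rintro t ht ω ⟨i, j, hij⟩
    have ht0 : (0 : ℝ) < t := by exact_mod_cast ht
    rw [Set.mem_iUnion]
    have hN : (t : ℝ) * ((transitions (fun s => X s ω) t i j : ℝ) / t) =
      transitions (fun s => X s ω) t i j := mul_div_cancel₀ _ ht0.ne'
    rcases le_abs'.mp hij with h | h
    · refine ⟨((i, j), false), ?_⟩
      have := mul_le_mul_of_nonneg_left h ht0.le
      simp only [E, Set.mem_ofPred_eq, Bool.false_eq_true, if_false]
      nlinarith
    · refine ⟨((i, j), true), ?_⟩
      have := mul_le_mul_of_nonneg_left h ht0.le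
      simp only [E, Set.mem_ofPred_eq, if_true]
      nlinarith
  -- Time `0`, where the frequencies divide by zero, is split off and contributes at most a finite
  -- amount.
  rw [tsum_eq_zero_add' ENNReal.summable]
  refine ENNReal.add_ne_top.mpr ⟨measure_ne_top _ _, ?_⟩
  have hfin : ∑ z, ∑' t, ℙ (E z t) ≠ ⊤ := ENNReal.sum_ne_top.mpr fun z _ => hE z
  refine ne_top_of_le_ne_top hfin ?_
  rw [← Summable.tsum_finsetSum fun _ _ => ENNReal.summable]
  refine le_trans (ENNReal.tsum_le_tsum fun t => ?_)
    (ENNReal.tsum_comp_le_tsum_of_injective (add_left_injective 1) _)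
  exact (measure_mono (hsub (t + 1) (by omega))).trans (measure_iUnion_fintype_le _ _)

/-- The expected stopping time is at most `log (1/α) / c` up to an additive constant, for every
rate `c` below the information bound. -/
theorem IsMarkovChain.expectedStoppingTime_le (hX : IsMarkovChain ℙ X ν Q)
    (hν : ν ∈ stdSimplex ℝ ι) (hQ : Q ∈ Matrix.rowStochastic ℝ ι) (hirr : Q.IsIrreducible)
    {H₀ : Set (Matrix ι ι ℝ)} (hH : IsCompact H₀)
    (hH' : ∀ P ∈ H₀, P ∈ Matrix.rowStochastic ℝ ι) {c c' : ℝ} (hc : 0 < c) (hcc' : c < c')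
    (hcD : ENNReal.ofReal c' < infStationaryKL Q H₀) :
    ∃ C : ℝ≥0∞, C ≠ ⊤ ∧ ∀ α ∈ Set.Ioo (0 : ℝ) 1,
      expectedStoppingTime ℙ X H₀ α ≤ ENNReal.ofReal (Real.log (1 / α) / c) + C := by
  have : Nonempty ι := by
    by_contra hne
    rw [not_nonempty_iff] at hne
    simpa using hν.2
  have hρ := stationaryDist_isStationary hQ
  obtain ⟨δ, hδ, hstat⟩ := exists_statistic_lower_bound hQ hρ.1.1 hH hH'
    (hc.trans hcc').le hcD
  obtain ⟨T₀, hT₀⟩ := exists_boundary_le (ι := ι) (sub_pos.mpr hcc')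
  -- Measurable hulls have the same measure and allow the sum and the integral to be exchanged.
  let bad : ℕ → Set Ω := fun t =>
    toMeasurable ℙ (frequencyDeviation X (fun i j => stationaryDist Q i * Q i j) δ t)
  have hbad : ∑' t, ℙ (bad t) ≠ ⊤ := by
    simp only [bad, measure_toMeasurable]
    exact hX.tsum_frequencyDeviation_ne_top hν hQ hirr hρ hδ
  refine ⟨(T₀ + 2 : ℕ) + ∑' t, ℙ (bad t), ENNReal.add_ne_top.mpr
    ⟨ENNReal.natCast_ne_top _, hbad⟩, fun α hα => ?_⟩
  have hlog : 0 ≤ Real.log (1 / α) := Real.log_nonneg (one_le_one_div hα.1 hα.2.le)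
  -- For `t ≥ T` the boundary is at most `c t + (c' - c) t = c' t`, which the statistic reaches
  -- outside `bad t`.
  set T : ℕ := ⌈Real.log (1 / α) / c⌉₊ + (T₀ + 1) with hT
  have hpt : ∀ ω, ((stoppingTime H₀ α fun t => X t ω : ℕ∞) : ℝ≥0∞) ≤
      T + ∑' t, (bad t).indicator (fun _ => (1 : ℝ≥0∞)) ω := by
    intro ω
    refine iInf_natCast_le_add_tsum _ {t | ω ∈ bad t} T fun t ht hω => ?_
    have ht1 : 1 ≤ t := by omega
    refine ⟨ht1, le_trans (ENNReal.ofReal_le_ofReal ?_) (hstat _ t ht1 ?_)⟩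
    · refine (hT₀ t (by omega) α _).trans ?_
      have h1 : Real.log (1 / α) / c ≤ t :=
        (Nat.le_ceil _).trans (by exact_mod_cast (by omega : ⌈Real.log (1 / α) / c⌉₊ ≤ t))
      rw [div_le_iff₀ hc] at h1
      linarith
    · intro i j
      by_contra hij
      exact hω (subset_toMeasurable _ _ ⟨i, j, not_lt.mp hij⟩)
  have hTle : (T : ℝ≥0∞) ≤ ENNReal.ofReal (Real.log (1 / α) / c) + (T₀ + 2 : ℕ) := by
    have h0 : 0 ≤ Real.log (1 / α) / c := div_nonneg hlog hc.le
    rw [← ENNReal.ofReal_natCast, ← ENNReal.ofReal_natCast (T₀ + 2),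
      ← ENNReal.ofReal_add h0 (Nat.cast_nonneg _)]
    refine ENNReal.ofReal_le_ofReal ?_
    have := (Nat.ceil_lt_add_one h0).le
    rw [hT]
    push_cast
    linarith
  calc expectedStoppingTime ℙ X H₀ α
      ≤ ∫⁻ ω, (T + ∑' t, (bad t).indicator (fun _ => (1 : ℝ≥0∞)) ω) ∂ℙ := lintegral_mono hpt
    _ = T + ∑' t, ℙ (bad t) := by
      rw [lintegral_add_left measurable_const, lintegral_const, measure_univ, mul_one,
        lintegral_tsum fun t => (measurable_const.indicator
          (measurableSet_toMeasurable _ _)).aemeasurable]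
      congr 1
      refine tsum_congr fun t => ?_
      rw [lintegral_indicator (measurableSet_toMeasurable _ _), setLIntegral_one]
    _ ≤ ENNReal.ofReal (Real.log (1 / α) / c) + (T₀ + 2 : ℕ) + ∑' t, ℙ (bad t) := by gcongr
    _ = _ := add_assoc _ _ _

/-- Asymptotic optimality of the test of a compact null hypothesis under an irreducible
alternative. -/
theorem IsMarkovChain.limsup_expectedStoppingTime_le (hX : IsMarkovChain ℙ X ν Q)
    (hν : ν ∈ stdSimplex ℝ ι) (hQ : Q ∈ Matrix.rowStochastic ℝ ι) (hirr : Q.IsIrreducible)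
    {H₀ : Set (Matrix ι ι ℝ)} (hH : IsCompact H₀)
    (hH' : ∀ P ∈ H₀, P ∈ Matrix.rowStochastic ℝ ι) :
    limsup (fun α : ℝ => expectedStoppingTime ℙ X H₀ α / ENNReal.ofReal (Real.log (1 / α)))
      (𝓝[>] 0) ≤ 1 / infStationaryKL Q H₀ := by
  -- Passing to inverses reduces the claim to finite rates `c` below the information bound, which
  -- treats the values `0` and `∞` along with the rest.
  rw [one_div, ENNReal.le_inv_iff_le_inv]
  refine ENNReal.le_of_forall_nnreal_lt fun c hcD => ?_
  rw [ENNReal.le_inv_iff_le_inv]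
  rcases eq_or_ne c 0 with rfl | hc0
  · simp
  have hc : (0 : ℝ) < c := by positivity
  obtain ⟨c', hcc', hc'D⟩ := ENNReal.lt_iff_exists_nnreal_btwn.mp hcD
  obtain ⟨C, hC, hbound⟩ := hX.expectedStoppingTime_le hν hQ hirr hH hH' hc
    (c' := c') (by exact_mod_cast hcc') (by rwa [ENNReal.ofReal_coe_nnreal])
  have hlog : Tendsto (fun α : ℝ => Real.log (1 / α)) (𝓝[>] 0) atTop := by
    simp_rw [one_div]
    exact Real.tendsto_log_atTop.comp tendsto_inv_nhdsGT_zero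
  have hlim : Tendsto (fun α : ℝ => (c : ℝ≥0∞)⁻¹ + C / ENNReal.ofReal (Real.log (1 / α)))
      (𝓝[>] 0) (𝓝 (c : ℝ≥0∞)⁻¹) := by
    have h1 := ENNReal.Tendsto.const_div (ENNReal.tendsto_ofReal_atTop.comp hlog)
      (Or.inr hC)
    rw [ENNReal.div_top] at h1
    simpa using h1.const_add (c : ℝ≥0∞)⁻¹
  refine (limsup_le_limsup ?_).trans_eq hlim.limsup_eq
  filter_upwards [Ioo_mem_nhdsGT (zero_lt_one' ℝ)] with α hα
  have hpos : 0 < Real.log (1 / α) := Real.log_pos (one_lt_one_div hα.1 hα.2)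
  have hne : ENNReal.ofReal (Real.log (1 / α)) ≠ 0 := (ENNReal.ofReal_pos.mpr hpos).ne'
  refine (ENNReal.div_le_div_right (hbound α hα) _).trans_eq ?_
  rw [ENNReal.add_div, ENNReal.ofReal_div_of_pos hc, ENNReal.ofReal_coe_nnreal, div_eq_mul_inv,
    div_eq_mul_inv, mul_right_comm, ENNReal.mul_inv_cancel hne ENNReal.ofReal_ne_top, one_mul]

end StoppingTime

/-! ### Compactness of the linear null class -/

section LinearNull

variable {S A : Type*} [Fintype S] [Fintype A] {d : ℕ}

/-- Turns the norm constraint into membership in a product of balls; `0 ≤ r` covers empty `S`, where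
the supremum is `0`. -/
theorem normTwoInf_le_iff {μ : Matrix S (Fin d) ℝ} {r : ℝ} (hr : 0 ≤ r) :
    normTwoInf μ ≤ r ↔
      ∀ s, (WithLp.toLp 2 (μ s) : EuclideanSpace ℝ (Fin d)) ∈ Metric.closedBall 0 r := by
  simp only [mem_closedBall_zero_iff]
  exact ⟨fun h s => (le_ciSup (Set.finite_range fun s =>
    ‖(WithLp.toLp 2 (μ s) : EuclideanSpace ℝ (Fin d))‖).bddAbove s).trans h,
    fun h => Real.iSup_le h hr⟩

variable [DecidableEq S] [DecidableEq A]

/-- The class is the continuous image of a product of closed balls, intersected with the closed set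
of stochastic matrices. -/
theorem isCompact_linearNull (φ : S → A → EuclideanSpace ℝ (Fin d)) (π : Policy S A) :
    IsCompact (linearNull φ π) := by
  let F : (S → EuclideanSpace ℝ (Fin d)) → Matrix (S × A) (S × A) ℝ := fun μ =>
    featureMatrix φ * (Matrix.of fun s k => μ s k)ᵀ * π.matrix
  have hF : Continuous F := by
    refine (continuous_const.matrix_mul (Continuous.matrix_transpose ?_)).matrix_mul
      continuous_const
    exact continuous_matrix fun s k => by simp only [Matrix.of_apply]; fun_prop
  have hK : IsCompact (Set.univ.pi fun _ : S =>
      Metric.closedBall (0 : EuclideanSpace ℝ (Fin d)) √(d : ℝ)) :=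
    isCompact_univ_pi fun _ => isCompact_closedBall _ _
  have hclosed : IsClosed {P : Matrix (S × A) (S × A) ℝ |
      P ∈ Matrix.rowStochastic ℝ (S × A)} := by
    simp only [Matrix.mem_rowStochastic, Set.ofPred_and, Set.ofPred_forall]
    refine IsClosed.inter (isClosed_iInter fun i => isClosed_iInter fun j =>
      isClosed_le continuous_const (continuous_id.matrix_elem i j)) ?_
    exact isClosed_eq (continuous_id.matrix_mulVec continuous_const) continuous_const
  convert (hK.image hF).inter_left hclosed using 1
  ext P
  refine and_congr_right fun _ => ⟨?_, ?_⟩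
  · rintro ⟨μ, hμ, rfl⟩
    exact ⟨fun s => WithLp.toLp 2 (μ s),
      fun s _ => (normTwoInf_le_iff (Real.sqrt_nonneg _)).mp hμ s, rfl⟩
  · rintro ⟨μ, hμ, rfl⟩
    exact ⟨Matrix.of fun s k => μ s k, (normTwoInf_le_iff (Real.sqrt_nonneg _)).mpr
      fun s => hμ s (Set.mem_univ s), rfl⟩

end LinearNull

end MarkovTest

theorem mainTheorem7 {S A Ω : Type*} [Fintype S] [Fintype A] [DecidableEq S] [DecidableEq A]
    [MeasurableSpace Ω] {d : ℕ}
    (M : FiniteMDP S A) (π : Policy S A) (φ : S → A → EuclideanSpace ℝ (Fin d))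
    (hφ : ∀ s a, ‖φ s a‖ ≤ 1)
    (hM : ¬ M.IsLinear φ)
    (hQ : IsErgodic (M.inducedKernel π))
    (ℙ : Measure Ω) [IsProbabilityMeasure ℙ] (X : ℕ → Ω → S × A)
    (ν : S × A → ℝ) (hν : ν ∈ stdSimplex ℝ (S × A))
    (hX : IsMarkovChain ℙ X ν (M.inducedKernel π)) :
    IsCompact (linearNull φ π) ∧
      limsup (fun α : ℝ =>
          expectedStoppingTime ℙ X (linearNull φ π) α / ENNReal.ofReal (Real.log (1 / α)))
        (𝓝[>] 0)
        ≤ 1 / infStationaryKL (M.inducedKernel π) (linearNull φ π) := by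
  exact ⟨isCompact_linearNull φ π, hX.limsup_expectedStoppingTime_le hν hQ.stochastic
    hQ.irreducible (isCompact_linearNull φ π) fun _ hP => hP.1⟩
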